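/- Let $\mathrm{Hig} = \langle a,b,c,d \mid a^{-1}ba=b^2,\ b^{-1}cb=c^2,\ c^{-1}dc=d^2,\ d^{-1}ad=a^2\rangle$ be the Higman $4$-group, let $z \in \mathrm{Hig}$ be an element of infinite order, and let $K = \mathrm{Hig} *_{\langle z\rangle} \mathrm{Hig}$ be the amalgamated free product of $\mathrm{Hig}$ with itself along the subgroup generated by $z$. Let $1 \to \mathbb{Z} \to L \to K \to 1$ be a central extension classified by a generator of $H^2(K;\mathbb{Z})$, and let $1 \to \mathbb{Z} \to N \to \mathbb{Z}^2 \to 1$ be a central extension classified by a generator of $H^2(\mathbb{Z}^2;\mathbb{Z})$. Put $G = (N \times L)/\mathbb{Z}$, where $\mathbb{Z}$ is embedded diagonally as a central subgroup of $N \times L$; regard $N = N \times 1$ as a subgroup of $G$, and let $e \in \mathbb{Z} \subset N \subset G$ be the generator of the central subgroup $\mathbb{Z}$ of $N$. Let $p : G \to N/\mathbb{Z} \times L/\mathbb{Z} \to L/\mathbb{Z} = K$ be the canonical projection. 1. If $H \subset G$ is a subgroup with $p(H) = K$, then $e \in H$. 2. If $k \geq 0$ and $H \subset G \times \mathbb{Z}^k$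 is a subgroup that maps onto $K$ under the canonical map $G \times \mathbb{Z}^k \to G \xrightarrow{p} K$, then $(e, 0) \in H$. -/

import Mathlib

/-- The four generators `a, b, c, d` of the Higman group. -/
inductive HigmanGen : Type
  | a | b | c | d

/-- The relators of the Higman group: `a⁻¹ba = b²`, `b⁻¹cb = c²`, `c⁻¹dc = d²`, `d⁻¹ad = a²`. -/
def higmanRels : Set (FreeGroup HigmanGen) :=
  let a := FreeGroup.of HigmanGen.a
  let b := FreeGroup.of HigmanGen.b
  let c := FreeGroup.of HigmanGen.c
  let d := FreeGroup.of HigmanGen.d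
  {a⁻¹ * b * a * (b ^ 2)⁻¹, b⁻¹ * c * b * (c ^ 2)⁻¹,
    c⁻¹ * d * c * (d ^ 2)⁻¹, d⁻¹ * a * d * (a ^ 2)⁻¹}

/-- The Higman group
`⟨a, b, c, d | a⁻¹ba = b², b⁻¹cb = c², c⁻¹dc = d², d⁻¹ad = a²⟩`. -/
abbrev Hig : Type := PresentedGroup higmanRels

/-- The amalgamated free product `Hig *_{⟨z⟩} Hig` of two copies of the Higman group along
the cyclic subgroup generated by `z`. -/
abbrev HigAmalgam (z : Hig) : Type :=
  Monoid.PushoutI (fun _ : Fin 2 => (Subgroup.zpowers z).subtype)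

/-- The second cohomology group `H²(Q; ℤ)` with trivial integer coefficients. -/
noncomputable abbrev H2Int (Q : Type) [Group Q] : Type :=
  groupCohomology.H2 (Rep.trivial ℤ Q ℤ)

/-- A central extension `1 → ℤ → E → Q → 1`. -/
structure CentralIntExtension (E : Type*) (Q : Type*) [Group E] [Group Q]
    extends GroupExtension (Multiplicative ℤ) E Q where
  /-- The image of `ℤ` is central in `E`. -/
  central : ∀ (n : Multiplicative ℤ) (x : E), inl n * x = x * inl n

/-- The central extension `S` of `Q` by `ℤ` is classified by `c ∈ H²(Q; ℤ)`: for a set-theoretic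
section `σ`, the factor set `f`, determined by `σ g * σ h = f (g, h) * σ (g * h)`, is a cocycle
that represents `c`. -/
def CentralIntExtension.IsClassifiedBy {E : Type*} {Q : Type} [Group E] [Group Q]
    (S : CentralIntExtension E Q) (c : H2Int Q) : Prop :=
  ∃ (σ : S.Section) (f : groupCohomology.cocycles₂ (Rep.trivial ℤ Q ℤ)),
    (∀ g h : Q, σ g * σ h = S.inl (Multiplicative.ofAdd (f (g, h) : ℤ)) * σ (g * h)) ∧
      groupCohomology.H2π (Rep.trivial ℤ Q ℤ) f = c

/-- The free abelian group `ℤᵏ`, written multiplicatively. -/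
abbrev FreeAb (k : ℕ) : Type := Multiplicative (Fin k → ℤ)

namespace CentralIntExtension

variable {N L A K : Type*} [Group N] [Group L] [Group A] [Group K]

/-- The diagonal embedding of the central subgroup `ℤ` into `N × L`. -/
def diag (T : CentralIntExtension N A) (S : CentralIntExtension L K) :
    Multiplicative ℤ →* N × L :=
  T.inl.prod S.inl

instance diag_range_normal (T : CentralIntExtension N A) (S : CentralIntExtension L K) :
    (diag T S).range.Normal := by
  refine ⟨?_⟩
  rintro _ ⟨n, rfl⟩ g
  refine ⟨n, ?_⟩
  ext
  · simp [diag, ← T.central]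
  · simp [diag, ← S.central]

/-- The group `G = (N × L) / ℤ`. -/
abbrev CentralProduct (T : CentralIntExtension N A) (S : CentralIntExtension L K) : Type _ :=
  (N × L) ⧸ (diag T S).range

/-- The inclusion `N = N × 1 ⊂ N × L → G`. -/
def inclN (T : CentralIntExtension N A) (S : CentralIntExtension L K) :
    N →* CentralProduct T S :=
  (QuotientGroup.mk' (diag T S).range).comp (MonoidHom.inl N L)

/-- The generator `e` of `ℤ ⊂ N ⊂ G`. -/
def centralGen (T : CentralIntExtension N A) (S : CentralIntExtension L K) :
    CentralProduct T S :=
  inclN T S (T.inl (Multiplicative.ofAdd 1))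

/-- The canonical map `G → N/ℤ × L/ℤ = A × K`. -/
def toBases (T : CentralIntExtension N A) (S : CentralIntExtension L K) :
    CentralProduct T S →* A × K :=
  QuotientGroup.lift (diag T S).range (T.rightHom.prodMap S.rightHom) (by
    rintro _ ⟨n, rfl⟩
    simp [diag])

/-- The canonical map `p : G → N/ℤ × L/ℤ → L/ℤ = K`. -/
def proj (T : CentralIntExtension N A) (S : CentralIntExtension L K) :
    CentralProduct T S →* K :=
  (MonoidHom.snd A K).comp (toBases T S)

end CentralIntExtension

/-! The commutator subgroup `⁅H, H⁆` dies in the abelian group `N/ℤ = ℤ²`, so it lies in the image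
of `L` in `G`; as `K` is perfect, it still maps onto `K`. Its preimage `D ≤ L` thus maps onto `K`
and meets the central `ℤ` in some `mℤ`. Moving a section into `D` makes the factor set divisible by
`m`, so `m` divides the class `c` (`IsClassifiedBy.exists_zsmul_eq`). Since `c` generates `H²(K; ℤ)`
and that group has an element of infinite order, `m` is a unit and `D` contains `ℤ`.

The element of infinite order (`HigAmalgam.exists_zsmul_ne_zero`) comes from gluing two copies of
`Hig × ℤ` along `⟨z⟩ × ℤ` with a twist by `⟨z⟩ ≅ ℤ`, an explicit Mayer–Vietoris connecting map.

With an extra factor `ℤᵏ`, passing to commutators also kills the `ℤᵏ` coordinate. -/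

open groupCohomology in
/-- The cocycle condition for integral 2-cochains with trivial action. -/
theorem mem_cocycles₂_trivial_int_iff {Q : Type} [Group Q] (f : Q × Q → ℤ) :
    (f : Q × Q → Rep.trivial ℤ Q ℤ) ∈ cocycles₂ (Rep.trivial ℤ Q ℤ) ↔
      ∀ g h j : Q, f (g * h, j) + f (g, h) = f (h, j) + f (g, h * j) :=
  mem_cocycles₂_iff (A := Rep.trivial ℤ Q ℤ) f

open groupCohomology in
/-- The coboundary condition for integral 2-cochains with trivial action. -/
theorem mem_coboundaries₂_trivial_int_iff {Q : Type} [Group Q] (f : Q × Q → ℤ) :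
    (f : Q × Q → Rep.trivial ℤ Q ℤ) ∈ coboundaries₂ (Rep.trivial ℤ Q ℤ) ↔
      ∃ u : Q → ℤ, ∀ g h : Q, u h - u (g * h) + u g = f (g, h) := by
  constructor
  · rintro ⟨u, hu⟩
    exact ⟨u, fun g h => congrFun hu (g, h)⟩
  · rintro ⟨u, hu⟩
    exact ⟨u, funext fun x => hu x.1 x.2⟩

/-! ### Perfectness of the Higman group and of its amalgam. -/

theorem Group.commutator_eq_top_of_forall_hom_eq_one {G : Type*} [Group G]
    (h : ∀ f : G →* Abelianization G, f = 1) : commutator G = ⊤ := by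
  rw [← Abelianization.ker_of, h Abelianization.of, MonoidHom.ker_one]

/-- In an abelian group each relation `x⁻¹yx = y²` becomes `y = y²`, and every generator occurs once
as `y`. -/
theorem Hig.hom_eq_one {A : Type*} [CommGroup A] (f : Hig →* A) : f = 1 := by
  have aux : ∀ x y : Hig, x⁻¹ * y * x * (y ^ 2)⁻¹ = 1 → f y = 1 := by
    intro x y h
    have h' : f y * (f y ^ 2)⁻¹ = 1 := by simpa using congrArg f h
    rw [mul_inv_eq_one, pow_two] at h'
    exact left_eq_mul.1 h'
  have key : ∀ r ∈ higmanRels, PresentedGroup.mk higmanRels r = 1 :=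
    fun _ hr => PresentedGroup.one_of_mem hr
  ext x
  cases x with
  | a => exact aux (.of .d) _ (key _ (.inr (.inr (.inr rfl))))
  | b => exact aux (.of .a) _ (key _ (.inl rfl))
  | c => exact aux (.of .b) _ (key _ (.inr (.inl rfl)))
  | d => exact aux (.of .c) _ (key _ (.inr (.inr (.inl rfl))))

theorem HigAmalgam.commutator_eq_top (z : Hig) : commutator (HigAmalgam z) = ⊤ :=
  Group.commutator_eq_top_of_forall_hom_eq_one fun f =>
    Monoid.PushoutI.hom_ext_nonempty fun i => by
      rw [Hig.hom_eq_one (f.comp _), MonoidHom.one_comp]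

/-! ### Central extensions of amalgams glued by shears. -/

namespace Monoid.PushoutI

variable {ι H : Type*} {G : ι → Type*} [∀ i, Group (G i)] [Group H]

/-- The map `H × ℤ → G i × ℤ` given by `φ i` and by the shear `(h, n) ↦ n + θ i h`. -/
def shear (φ : ∀ i, H →* G i) (θ : ι → H →* Multiplicative ℤ) (i : ι) :
    H × Multiplicative ℤ →* G i × Multiplicative ℤ :=
  ((φ i).comp (MonoidHom.fst _ _)).prod
    (MonoidHom.snd _ _ * (θ i).comp (MonoidHom.fst _ _))

variable (φ : ∀ i, H →* G i) (θ : ι → H →* Multiplicative ℤ)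

@[simp]
theorem shear_apply (i : ι) (h : H) (n : Multiplicative ℤ) :
    shear φ θ i (h, n) = (φ i h, n * θ i h) := rfl

variable {φ} in
theorem shear_injective (hφ : ∀ i, Function.Injective (φ i)) (i : ι) :
    Function.Injective (shear φ θ i) := by
  rintro ⟨h, n⟩ ⟨h', n'⟩ e
  simp only [shear_apply, Prod.mk.injEq] at e
  obtain rfl := hφ i e.1
  simpa using e.2

/-- The central copy of `ℤ` in the amalgam of the groups `G i × ℤ` along the shears. -/
def shearInl : Multiplicative ℤ →* PushoutI (shear φ θ) :=
  (base _).comp (MonoidHom.inr _ _)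

theorem of_inr_eq_shearInl (i : ι) (n : Multiplicative ℤ) :
    of (φ := shear φ θ) i (1, n) = shearInl φ θ n := by
  have := of_apply_eq_base (shear φ θ) i (1, n)
  simpa [shearInl] using this

theorem shearInl_comm (n : Multiplicative ℤ) (x : PushoutI (shear φ θ)) :
    shearInl φ θ n * x = x * shearInl φ θ n := by
  induction x using PushoutI.induction_on with
  | of i g =>
    rw [← of_inr_eq_shearInl φ θ i, ← map_mul, ← map_mul, Prod.mul_def, Prod.mul_def]
    simp [mul_comm]
  | base h =>
    rw [shearInl, MonoidHom.comp_apply, ← map_mul, ← map_mul, Prod.mul_def, Prod.mul_def]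
    simp [mul_comm]
  | mul x y hx hy => rw [← mul_assoc, hx, mul_assoc, hy, mul_assoc]

/-- The projection from the amalgam of the groups `G i × ℤ` to that of the groups `G i`. -/
def shearRight : PushoutI (shear φ θ) →* PushoutI φ :=
  lift (fun i => (of i).comp (MonoidHom.fst _ _)) ((base φ).comp (MonoidHom.fst _ _))
    fun i => MonoidHom.ext fun x => of_apply_eq_base φ i x.1

@[simp]
theorem shearRight_of (i : ι) (x : G i × Multiplicative ℤ) :
    shearRight φ θ (of i x) = of i x.1 := by
  simp [shearRight]

@[simp]
theorem shearRight_shearInl (n : Multiplicative ℤ) : shearRight φ θ (shearInl φ θ n) = 1 := by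
  simp [shearRight, shearInl]

instance shearInl_range_normal : (shearInl φ θ).range.Normal := by
  refine ⟨?_⟩
  rintro _ ⟨n, rfl⟩ g
  exact ⟨n, by rw [← shearInl_comm, mul_inv_cancel_right]⟩

/-- The map from the amalgam of the groups `G i` to the amalgam of the groups `G i × ℤ` modulo
its central copy of `ℤ`, inverse to the map induced by `shearRight`. -/
def toShearQuotient : PushoutI φ →* PushoutI (shear φ θ) ⧸ (shearInl φ θ).range :=
  lift (fun i => (QuotientGroup.mk' _).comp ((of i).comp (MonoidHom.inl _ _)))
    ((QuotientGroup.mk' _).comp ((base _).comp (MonoidHom.inl _ _))) fun i => by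
      ext h
      simp only [MonoidHom.comp_apply, MonoidHom.inl_apply, QuotientGroup.mk'_apply]
      rw [← of_apply_eq_base _ i, shear_apply, QuotientGroup.eq, ← map_inv, ← map_mul]
      refine ⟨θ i h, ?_⟩
      rw [← of_inr_eq_shearInl φ θ i]
      simp

/-- This gives exactness in the middle: whatever `shearRight` kills is already trivial modulo the
central `ℤ`. -/
theorem toShearQuotient_comp_shearRight [Nonempty ι] :
    (toShearQuotient φ θ).comp (shearRight φ θ) = QuotientGroup.mk' (shearInl φ θ).range := by
  refine hom_ext_nonempty fun i => MonoidHom.ext fun x => ?_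
  simp only [MonoidHom.comp_apply, shearRight_of, toShearQuotient, lift_of, MonoidHom.inl_apply,
    QuotientGroup.mk'_apply]
  rw [QuotientGroup.eq, ← map_inv, ← map_mul]
  exact ⟨x.2, by rw [← of_inr_eq_shearInl φ θ i]; congr 1; ext <;> simp⟩

/-- The central extension by `ℤ` of an amalgam that is trivial over the factors and glued along
the homomorphisms `θ i` over the amalgamated subgroup. -/
def shearExtension [Nonempty ι] (hφ : ∀ i, Function.Injective (φ i)) :
    CentralIntExtension (PushoutI (shear φ θ)) (PushoutI φ) where
  inl := shearInl φ θ
  rightHom := shearRight φ θ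
  inl_injective :=
    (base_injective (shear_injective θ hφ)).comp fun _ _ h => congrArg Prod.snd h
  range_inl_eq_ker_rightHom := by
    refine le_antisymm ?_ fun x hx => ?_
    · rintro _ ⟨n, rfl⟩
      simp [MonoidHom.mem_ker]
    · have := DFunLike.congr_fun (toShearQuotient_comp_shearRight φ θ) x
      rw [MonoidHom.comp_apply, MonoidHom.mem_ker.1 hx, map_one] at this
      exact (QuotientGroup.eq_one_iff x).1 this.symm
  rightHom_surjective x := by
    induction x using PushoutI.induction_on with
    | of i g => exact ⟨of i (g, 1), by simp⟩
    | base h => exact ⟨base _ (h, 1), by simp [shearRight]⟩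
    | mul x y hx hy =>
      obtain ⟨x', rfl⟩ := hx
      obtain ⟨y', rfl⟩ := hy
      exact ⟨x' * y', map_mul _ _ _⟩
  central := shearInl_comm φ θ

end Monoid.PushoutI

/-! ### Factor sets and divisibility of extension classes. -/

namespace CentralIntExtension

variable {E : Type*} {Q : Type} [Group E] [Group Q] (S : CentralIntExtension E Q)

/-- Every element that maps to `1` comes from `ℤ`. -/
theorem exists_inl_eq {x : E} (hx : S.rightHom x = 1) :
    ∃ n : ℤ, S.inl (Multiplicative.ofAdd n) = x := by
  rw [← MonoidHom.mem_ker, ← S.range_inl_eq_ker_rightHom] at hx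
  exact hx

theorem inl_ofAdd_injective {m n : ℤ}
    (h : S.inl (Multiplicative.ofAdd m) = S.inl (Multiplicative.ofAdd n)) : m = n :=
  S.inl_injective h

/-- The product of `inl m * x` and `inl n * y`. -/
theorem inl_mul_mul_inl_mul (m n : ℤ) (x y : E) :
    S.inl (.ofAdd m) * x * (S.inl (.ofAdd n) * y) = S.inl (.ofAdd (m + n)) * (x * y) := by
  rw [mul_assoc, ← mul_assoc x, ← S.central, ofAdd_add, map_mul]
  simp only [mul_assoc]

/-- The factor set of any lift of `Q` to `E` satisfies the cocycle condition. -/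
theorem factorSet_cocycle (σ : Q → E) (f : Q × Q → ℤ)
    (hf : ∀ g h, σ g * σ h = S.inl (.ofAdd (f (g, h))) * σ (g * h)) (g h j : Q) :
    f (g * h, j) + f (g, h) = f (h, j) + f (g, h * j) := by
  have h₁ : σ g * σ h * σ j = S.inl (.ofAdd (f (g, h) + f (g * h, j))) * σ (g * h * j) := by
    rw [hf, mul_assoc, hf, ← mul_assoc, ← map_mul, ofAdd_add]
  have h₂ : σ g * (σ h * σ j) = S.inl (.ofAdd (f (h, j) + f (g, h * j))) * σ (g * h * j) := by
    rw [hf, ← mul_assoc, ← S.central, mul_assoc, hf, ← mul_assoc, ← map_mul, ofAdd_add, mul_assoc]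
  rw [mul_assoc, h₂] at h₁
  have := S.inl_ofAdd_injective (mul_right_cancel h₁)
  omega

theorem exists_isClassifiedBy : ∃ c : H2Int Q, S.IsClassifiedBy c := by
  let σ := S.surjInvRightHom
  have hex : ∀ x : Q × Q, ∃ n : ℤ, S.inl (.ofAdd n) = σ x.1 * σ x.2 * (σ (x.1 * x.2))⁻¹ :=
    fun x => S.exists_inl_eq (by simp)
  choose f hf using hex
  have hf' : ∀ g h, σ g * σ h = S.inl (.ofAdd (f (g, h))) * σ (g * h) := fun g h => by
    rw [hf, inv_mul_cancel_right]
  exact ⟨_, σ, ⟨f, (mem_cocycles₂_trivial_int_iff f).2 (S.factorSet_cocycle σ f hf')⟩, hf', rfl⟩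

variable {S}

theorem IsClassifiedBy.exists_factorSet {c : H2Int Q} (hc : S.IsClassifiedBy c) :
    ∃ (σ : S.Section) (f : Q × Q → ℤ)
      (hfc : (f : Q × Q → Rep.trivial ℤ Q ℤ) ∈ groupCohomology.cocycles₂ (Rep.trivial ℤ Q ℤ)),
      (∀ g h, σ g * σ h = S.inl (.ofAdd (f (g, h))) * σ (g * h)) ∧
        groupCohomology.H2π (Rep.trivial ℤ Q ℤ) ⟨f, hfc⟩ = c := by
  obtain ⟨σ, f, hf, rfl⟩ := hc
  exact ⟨σ, f.1, f.2, hf, rfl⟩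

/-- If a multiple `m • c` of the class of an extension vanishes, then multiplication by `m` on the
central `ℤ` extends to the whole group. -/
theorem IsClassifiedBy.exists_hom_of_zsmul_eq_zero {c : H2Int Q} (hc : S.IsClassifiedBy c) {m : ℤ}
    (hm : m • c = 0) :
    ∃ ψ : E →* Multiplicative ℤ, ∀ n, ψ (S.inl n) = n ^ m := by
  obtain ⟨σ, f, hfc, hf, rfl⟩ := hc.exists_factorSet
  rw [← map_zsmul, groupCohomology.H2π_eq_zero_iff] at hm
  obtain ⟨u, hu⟩ := (mem_coboundaries₂_trivial_int_iff
    (fun x => m * f x)).1 hm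
  have hex : ∀ x : E, ∃ n : ℤ, S.inl (.ofAdd n) * σ (S.rightHom x) = x := fun x => by
    obtain ⟨n, hn⟩ := S.exists_inl_eq (x := x * (σ (S.rightHom x))⁻¹) (by simp)
    exact ⟨n, by rw [hn, inv_mul_cancel_right]⟩
  choose v hv using hex
  have hv_mul : ∀ x y, v (x * y) = v x + v y + f (S.rightHom x, S.rightHom y) := fun x y => by
    apply S.inl_ofAdd_injective
    apply mul_right_cancel (b := σ (S.rightHom (x * y)))
    rw [hv]
    conv_lhs => rw [← hv x, ← hv y]
    rw [S.inl_mul_mul_inl_mul, hf, ← mul_assoc, ← map_mul, ← ofAdd_add, S.rightHom.map_mul]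
  let ψ : E →* Multiplicative ℤ := MonoidHom.mk'
    (fun x => .ofAdd (m * v x + u (S.rightHom x))) fun x y => by
      rw [← ofAdd_add, hv_mul, map_mul]
      congr 1
      have := hu (S.rightHom x) (S.rightHom y)
      linear_combination -this
  refine ⟨ψ, fun n => ?_⟩
  -- The section need not be normalized: `v 1 = -f (1, 1)` and `u 1 = m * f (1, 1)`, and these
  -- corrections cancel in `ψ`.
  have h₁ : v 1 + v 1 + f (1, 1) = v 1 := by simpa using (hv_mul 1 1).symm
  have h₂ : v (S.inl n) = n.toAdd + v 1 := by
    apply S.inl_ofAdd_injective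
    apply mul_right_cancel (b := σ (S.rightHom (S.inl n)))
    rw [hv, ofAdd_add, map_mul, mul_assoc, S.rightHom_inl, ← S.rightHom.map_one, hv, mul_one]
    rfl
  have h₃ := hu 1 1
  have h₁' : v 1 = -f (1, 1) := by
    linarith
  simp only [mul_one, sub_self, zero_add] at h₃
  change Multiplicative.ofAdd (m * v (S.inl n) + u (S.rightHom (S.inl n))) = _
  rw [h₂, S.rightHom_inl, h₃, h₁']
  apply Multiplicative.toAdd.injective
  simp only [toAdd_ofAdd, toAdd_zpow, smul_eq_mul]
  ring

/-- If a subgroup `D` maps onto `Q` and meets the central `ℤ` in `m ℤ`, then `m` divides the class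
of the extension. -/
theorem IsClassifiedBy.exists_zsmul_eq {c : H2Int Q} (hc : S.IsClassifiedBy c) (D : Subgroup E)
    (hD : D.map S.rightHom = ⊤) {m : ℤ}
    (hm : ∀ n : ℤ, S.inl (.ofAdd n) ∈ D → m ∣ n) : ∃ y : H2Int Q, c = m • y := by
  obtain ⟨σ, f, hfc, hf, rfl⟩ := hc.exists_factorSet
  have hex : ∀ g : Q, ∃ n : ℤ, S.inl (.ofAdd n) * σ g ∈ D := fun g => by
    obtain ⟨x, hx, rfl⟩ := hD.ge (Subgroup.mem_top g)
    obtain ⟨n, hn⟩ := S.exists_inl_eq (x := x * (σ (S.rightHom x))⁻¹) (by simp)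
    exact ⟨n, by rwa [hn, inv_mul_cancel_right]⟩
  choose u hu using hex
  have hF : ∀ g h, S.inl (.ofAdd (u g)) * σ g * (S.inl (.ofAdd (u h)) * σ h) =
      S.inl (.ofAdd (u g + u h + f (g, h) - u (g * h))) *
        (S.inl (.ofAdd (u (g * h))) * σ (g * h)) := fun g h => by
    rw [S.inl_mul_mul_inl_mul, hf, ← mul_assoc, ← mul_assoc, ← S.inl.map_mul, ← S.inl.map_mul,
      ← ofAdd_add, ← ofAdd_add, sub_add_cancel]
  have hdvd : ∀ x : Q × Q, m ∣ u x.1 + u x.2 + f x - u (x.1 * x.2) := fun x => by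
    refine hm _ ?_
    rw [eq_mul_inv_of_mul_eq (hF x.1 x.2).symm]
    exact D.mul_mem (D.mul_mem (hu _) (hu _)) (D.inv_mem (hu _))
  have hcoc := S.factorSet_cocycle (fun g => S.inl (.ofAdd (u g)) * σ g)
    (fun x => u x.1 + u x.2 + f x - u (x.1 * x.2)) hF
  obtain ⟨w, hw, hwm⟩ : ∃ w : Q × Q → ℤ,
      (∀ g h j : Q, w (g * h, j) + w (g, h) = w (h, j) + w (g, h * j)) ∧
      ∀ x : Q × Q, u x.1 + u x.2 + f x - u (x.1 * x.2) = m * w x := by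
    -- For `m = 0` the adjusted factor set vanishes, so `w = 0` serves; otherwise the cocycle
    -- identity survives division by `m`.
    rcases eq_or_ne m 0 with rfl | hm0
    · exact ⟨0, by simp, fun x => by simpa using hdvd x⟩
    · choose w hw using hdvd
      refine ⟨w, fun g h j => mul_left_cancel₀ hm0 ?_, hw⟩
      rw [mul_add, mul_add, ← hw, ← hw, ← hw, ← hw]
      exact hcoc g h j
  refine ⟨groupCohomology.H2π _ ⟨w, (mem_cocycles₂_trivial_int_iff w).2 hw⟩, ?_⟩
  rw [← map_zsmul, groupCohomology.H2π_eq_iff]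
  refine (mem_coboundaries₂_trivial_int_iff
    (fun x => f x - m * w x)).2 ⟨fun g => - u g, fun g h => ?_⟩
  have := hwm (g, h)
  simp only at this ⊢
  linarith

end CentralIntExtension

/-! ### An element of infinite order in `H²(K; ℤ)`, and its consequence for generators. -/

theorem Subgroup.exists_hom_zpowers_int {G : Type*} [Group G] {z : G} (hz : ¬ IsOfFinOrder z) :
    ∃ χ : Subgroup.zpowers z →* Multiplicative ℤ,
      χ ⟨z, Subgroup.mem_zpowers z⟩ = Multiplicative.ofAdd 1 := by
  let f := zpowersHom (Subgroup.zpowers z) ⟨z, Subgroup.mem_zpowers z⟩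
  have hf : Function.Bijective f := by
    refine ⟨fun m n h => ?_, ?_⟩
    · exact injective_zpow_iff_not_isOfFinOrder.2 hz (congrArg Subtype.val h)
    · rintro ⟨_, n, rfl⟩
      exact ⟨.ofAdd n, rfl⟩
  refine ⟨(MulEquiv.ofBijective f hf).symm, (MulEquiv.symm_apply_eq _).2 ?_⟩
  simp [f]

open Monoid.PushoutI in
/-- If `z` has infinite order, then `H²(Hig *_⟨z⟩ Hig; ℤ)` has an element of infinite order. -/
theorem HigAmalgam.exists_zsmul_ne_zero {z : Hig} (hz : ¬ IsOfFinOrder z) :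
    ∃ x : H2Int (HigAmalgam z), ∀ m : ℤ, m • x = 0 → m = 0 := by
  obtain ⟨χ, hχ⟩ := Subgroup.exists_hom_zpowers_int hz
  let φ : Fin 2 → Subgroup.zpowers z →* Hig := fun _ => (Subgroup.zpowers z).subtype
  -- Only the second factor is twisted, so the two gluings differ by `χ`.
  let θ : Fin 2 → Subgroup.zpowers z →* Multiplicative ℤ := ![1, χ]
  let P := shearExtension φ θ fun _ => Subtype.val_injective
  obtain ⟨x, hx⟩ := P.exists_isClassifiedBy
  refine ⟨x, fun m hm => ?_⟩
  obtain ⟨ψ, hψ⟩ := hx.exists_hom_of_zsmul_eq_zero hm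
  have hψ_of : ∀ (i : Fin 2) (g : Hig) (n : Multiplicative ℤ),
      ψ (of (φ := shear φ θ) i (g, n)) = n ^ m := fun i g n => by
    have h₁ := DFunLike.congr_fun
      (Hig.hom_eq_one (ψ.comp ((of (φ := shear φ θ) i).comp (MonoidHom.inl _ _)))) g
    simp only [MonoidHom.comp_apply, MonoidHom.inl_apply, MonoidHom.one_apply] at h₁
    have h₂ : ((g, n) : Hig × Multiplicative ℤ) = (g, 1) * (1, n) := by simp
    rw [h₂, map_mul, map_mul, h₁, one_mul, of_inr_eq_shearInl]
    exact hψ n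
  let w : Subgroup.zpowers z := ⟨z, Subgroup.mem_zpowers z⟩
  -- The amalgam identifies `(z, 0)` in the first factor with `(z, 1)` in the second (additively in
  -- `ℤ`). As `ψ` kills both copies of `Hig`, this reads `0 = m`.
  have h := (of_apply_eq_base (shear φ θ) 0 (w, 1)).trans
    (of_apply_eq_base (shear φ θ) 1 (w, 1)).symm
  replace h := congrArg ψ h
  rw [shear_apply, shear_apply, hψ_of, hψ_of] at h
  have : θ 1 w = .ofAdd 1 := hχ
  rw [this] at h
  simpa [θ, ← ofAdd_zsmul] using h.symm

/-- A generator of an infinite cyclic group is divisible only by units. -/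
theorem AddSubgroup.dvd_one_of_zmultiples_eq_top {A : Type*} [AddCommGroup A] {c x y : A} {m : ℤ}
    (hc : AddSubgroup.zmultiples c = ⊤) (hy : c = m • y) (hx : ∀ n : ℤ, n • x = 0 → n = 0) :
    m ∣ 1 := by
  obtain ⟨j, rfl⟩ := AddSubgroup.mem_zmultiples_iff.1 (hc.ge (AddSubgroup.mem_top y))
  obtain ⟨i, rfl⟩ := AddSubgroup.mem_zmultiples_iff.1 (hc.ge (AddSubgroup.mem_top x))
  have h : 1 - m * j = 0 := hx _ (by
    rw [smul_comm, sub_smul, mul_smul, one_smul, ← hy, sub_self, smul_zero])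
  exact ⟨j, by linarith⟩

/-- A subgroup of the extension of `Hig *_⟨z⟩ Hig` classified by a generator of `H²` that maps onto
`Hig *_⟨z⟩ Hig` contains the central `ℤ`. -/
theorem HigAmalgam.inl_mem_of_map_eq_top {z : Hig} (hz : ¬ IsOfFinOrder z)
    {c : H2Int (HigAmalgam z)} (hc : AddSubgroup.zmultiples c = ⊤)
    {L : Type*} [Group L] {S : CentralIntExtension L (HigAmalgam z)} (hS : S.IsClassifiedBy c)
    (D : Subgroup L) (hD : D.map S.rightHom = ⊤) (n : Multiplicative ℤ) : S.inl n ∈ D := by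
  obtain ⟨m, hm⟩ := Int.subgroup_cyclic (D.comap S.inl).toAddSubgroup'
  have hmem : ∀ n : ℤ, S.inl (.ofAdd n) ∈ D ↔ m ∣ n := fun n => by
    rw [← Int.mem_zmultiples_iff, AddSubgroup.zmultiples_eq_closure, ← hm]
    rfl
  obtain ⟨y, hy⟩ := hS.exists_zsmul_eq D hD fun n => (hmem n).1
  obtain ⟨x, hx⟩ := HigAmalgam.exists_zsmul_ne_zero hz
  exact (hmem n.toAdd).2 ((AddSubgroup.dvd_one_of_zmultiples_eq_top hc hy hx).trans (one_dvd _))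

/-! ### Commutators in the central product. -/

namespace CentralIntExtension

variable {N L A K : Type*} [Group N] [Group L] [CommGroup A] [Group K]

/-- If `K` is perfect and every subgroup of `L` over `K` contains the central `ℤ`, then the
commutator subgroup of any subgroup of `(N × L) / ℤ` over `K` contains the central `ℤ`. -/
theorem centralGen_mem_commutator (T : CentralIntExtension N A) (S : CentralIntExtension L K)
    (hK : commutator K = ⊤)
    (hS : ∀ D : Subgroup L, D.map S.rightHom = ⊤ → ∀ n, S.inl n ∈ D)
    (H : Subgroup (CentralProduct T S)) (hH : H.map (proj T S) = ⊤) :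
    centralGen T S ∈ ⁅H, H⁆ := by
  let q := QuotientGroup.mk' (diag T S).range
  let inclL : L →* CentralProduct T S := q.comp (MonoidHom.inr N L)
  have hq : ∀ n, q (T.inl n, S.inl n) = 1 := fun n =>
    (QuotientGroup.eq_one_iff _).2 ⟨n, rfl⟩
  have hA : ∀ g ∈ ⁅H, H⁆, (toBases T S g).1 = 1 := fun g hg => by
    have hle : ⁅H, H⁆ ≤ ((MonoidHom.fst A K).comp (toBases T S)).ker :=
      (Subgroup.commutator_mono le_top le_top).trans (Abelianization.commutator_subset_ker _)
    exact hle hg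
  have hD : (⁅H, H⁆.comap inclL).map S.rightHom = ⊤ := by
    refine top_unique fun k _ => ?_
    have hk : k ∈ ⁅H, H⁆.map (proj T S) := by
      rw [Subgroup.map_commutator, hH, ← commutator_def, hK]
      exact Subgroup.mem_top k
    obtain ⟨g, hg, rfl⟩ := hk
    obtain ⟨⟨n, l⟩, rfl⟩ := QuotientGroup.mk'_surjective _ g
    have hn : n ∈ T.rightHom.ker := hA _ hg
    rw [← T.range_inl_eq_ker_rightHom] at hn
    obtain ⟨t, rfl⟩ := hn
    -- Modulo the diagonal, `(T.inl t, l)` equals `(1, S.inl t⁻¹ * l)`, and the correction is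
    -- invisible in `K`.
    refine ⟨S.inl t⁻¹ * l, ?_, ?_⟩
    · have : inclL (S.inl t⁻¹ * l) = q (T.inl t, l) := by
        rw [← one_mul (inclL _), ← hq t]
        change q _ * q _ = _
        rw [← map_mul]
        simp
      rw [Subgroup.coe_comap, Set.mem_preimage, this]
      exact hg
    · rw [map_mul, S.rightHom_inl, one_mul]
      rfl
  have he : centralGen T S * inclL (S.inl (.ofAdd 1)) = 1 := by
    rw [← hq (.ofAdd 1)]
    change q _ * q _ = _
    rw [← map_mul]
    simp
  rw [eq_inv_of_mul_eq_one_left he]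
  exact inv_mem (hS _ hD _)

end CentralIntExtension

theorem mainTheorem9
    (z : Hig) (hz : ¬ IsOfFinOrder z)
    -- `c` is a generator of `H²(K; ℤ)`, `K = Hig *_{⟨z⟩} Hig`
    (c : H2Int (HigAmalgam z)) (hc : AddSubgroup.zmultiples c = ⊤)
    -- `1 → ℤ → L → K → 1` is the central extension classified by `c`
    {L : Type*} [Group L] (S : CentralIntExtension L (HigAmalgam z)) (hS : S.IsClassifiedBy c)
    -- `1 → ℤ → N → ℤ² → 1` is the central extension classified by a generator of `H²(ℤ²; ℤ)`
    (d : H2Int (FreeAb 2)) (hd : AddSubgroup.zmultiples d = ⊤)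
    {N : Type*} [Group N] (T : CentralIntExtension N (FreeAb 2)) (hT : T.IsClassifiedBy d) :
    (∀ H : Subgroup (CentralIntExtension.CentralProduct T S),
      H.map (CentralIntExtension.proj T S) = ⊤ →
        CentralIntExtension.centralGen T S ∈ H) ∧
    (∀ (k : ℕ) (H : Subgroup (CentralIntExtension.CentralProduct T S × FreeAb k)),
      H.map ((CentralIntExtension.proj T S).comp (MonoidHom.fst _ _)) = ⊤ →
        (CentralIntExtension.centralGen T S, 1) ∈ H) := by
  have key := CentralIntExtension.centralGen_mem_commutator T S (HigAmalgam.commutator_eq_top z)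
    (HigAmalgam.inl_mem_of_map_eq_top hz hc hS)
  refine ⟨fun H hH => Subgroup.commutator_le_self H (key H hH), fun k H hH => ?_⟩
  rw [← Subgroup.map_map] at hH
  have := key _ hH
  rw [← Subgroup.map_commutator] at this
  obtain ⟨⟨e, t⟩, he, rfl⟩ := this
  have ht : ⁅H, H⁆ ≤ (MonoidHom.snd (CentralIntExtension.CentralProduct T S) (FreeAb k)).ker :=
    (Subgroup.commutator_mono le_top le_top).trans (Abelianization.commutator_subset_ker _)
  obtain rfl : t = 1 := ht he
  exact Subgroup.commutator_le_self H he
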